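/- Let $\alpha,\nu\in(0,1]$, $\lambda>0$, $T\in(0,\infty)$ and $\rho\in[0,1]$. Let $M$ be a nonnegative integer valued random variable with probability generating function $$\mathbb{E}[u^{M}]=E_{\nu,1}(-\lambda^\alpha T^\nu(1-u)^\alpha),\qquad u\in[0,1],\qquad\text{where } E_{\nu,1}(x)=\sum_{r\ge0}\frac{x^r}{\Gamma(\nu r+1)},$$ and let $(X_n)_{n\ge1}$ be a sequence of random variables, independent of $M$, with common distribution function $F(t)=(t/T)^{\nu/\alpha}$ for $t\in[0,T]$ and correlation parameter $\rho$, that is: the law of the sequence is the mixture, with weights $1-\rho$ and $\rho$, of the law of an i.i.d. sequence with distribution function $F$ and of the law of a constant sequence $(X,X,\dots)$ with $X$ distributed according to $F$. For $t\in[0,T]$ put $$N_\rho^{\alpha,\nu}(t)=\sum_{n=1}^{M}1_{[0,t]}(X_n),\qquad p_k(t)=P(N_\rho^{\alpha,\nu}(t)=k)\quad(k\in\mathbb{Z}),$$ so that $p_k(t)=0$ for $k<0$. Let $\frac{d^\nu}{dt^\nu}$ be the Caputo derivative on $[0,T]$: $\frac{d^\nu}{dt^\nu}f(t)=\frac1{\Gamma(1-\nu)}\int_0^t\frac{f'(s)}{(t-s)^\nu}\,ds$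 if $\nu\in(0,1)$, and $\frac{d^\nu}{dt^\nu}f(t)=f'(t)$ if $\nu=1$ (left derivative at $t=T$). Let $(I-B)^\alpha f_k=\sum_{j\ge0}(-1)^j\binom{\alpha}{j}f_{k-j}$ be the fractional difference operator. Then, for every $t\in(0,T]$, the Caputo derivatives below exist (for $\nu<1$, each $p_k$ is absolutely continuous on $[0,t]$ and differentiable on $(0,t)$, and the integral converges absolutely), and $$\frac{d^\nu}{dt^\nu}p_0(t)=-\lambda^\alpha p_0(t)+\lambda^\alpha\rho-\rho(t/T)^{\nu/\alpha}\left(\lambda^\alpha+t^{-\nu}\frac{\Gamma(\nu/\alpha+1)}{\Gamma(\nu/\alpha-\nu+1)}\right)(1-p_0(T)),$$ and, for all $k\ge1$, $$\frac{d^\nu}{dt^\nu}p_k(t)=-\lambda^\alpha(I-B)^\alpha p_k(t)+\lambda^\alpha\rho\,(1-(t/T)^{\nu/\alpha})(-1)^k\binom{\alpha}{k}+\rho(t/T)^{\nu/\alpha}\left[\lambda^\alpha(I-B)^\alpha p_k(T)+t^{-\nu}\frac{\Gamma(\nu/\alpha+1)}{\Gamma(\nu/\alpha-\nu+1)}p_k(T)\right].$$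 Moreover $p_0(0)=1$ and $p_k(0)=0$ for all $k\ge1$. -/

import Mathlib

open MeasureTheory ProbabilityTheory

noncomputable section

/-- The two-parameter Mittag-Leffler function `E_{a,b}(x) = ∑_{r ≥ 0} x^r / Γ(a r + b)`
(the series converges absolutely for all real `x` when `a, b > 0`). -/
def mittagLeffler (a b x : ℝ) : ℝ :=
  ∑' r : ℕ, x ^ r / Real.Gamma (a * r + b)

/-- The fractional difference operator `(I - B)^α = ∑_{j ≥ 0} (-1)^j (α choose j) B^j`, where `B` is
the backward shift `(B f)(k) = f (k - 1)`. Sequences are indexed by `ℤ`; a probability mass function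
on the nonnegative integers vanishes at negative arguments, so that the series is a finite sum. -/
def fracDiff (α : ℝ) (f : ℤ → ℝ) (k : ℤ) : ℝ :=
  ∑' j : ℕ, (-1) ^ j * Ring.choose α j * f (k - j)

/-- `HasCaputoDerivAt ν T f c t`: the Caputo derivative of order `ν ∈ (0, 1]` (with base point `0`)
of the function `f`, considered on the interval `[0, T]`, exists at `t ∈ [0, T]` and equals `c`.

* For `ν = 1` this is the ordinary derivative of `f` on `[0, T]` (one-sided at the end points).
* For `ν < 1` it is `1 / Γ(1 - ν) * ∫_0^t (t - s)^(-ν) f'(s) ds`; the function is required to be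
  absolutely continuous on `[0, t]` and differentiable at all points of `(0, t)`,
  and the integral to converge absolutely. -/
def HasCaputoDerivAt (ν T : ℝ) (f : ℝ → ℝ) (c t : ℝ) : Prop :=
  if ν = 1 then HasDerivWithinAt f c (Set.Icc 0 T) t
  else AbsolutelyContinuousOnInterval f 0 t ∧
    DifferentiableOn ℝ f (Set.Ioo 0 t) ∧
    IntervalIntegrable (fun s => deriv f s / (t - s) ^ ν) volume 0 t ∧
    1 / Real.Gamma (1 - ν) * ∫ s in (0 : ℝ)..t, deriv f s / (t - s) ^ ν = c

/-- The law of a sequence of random variables with common law `Q` and correlation parameter `ρ`: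
with probability `1 - ρ` the variables are independent, with probability `ρ` they all coincide.
The variables have common law `Q`, and any two of them have correlation coefficient `ρ`. -/
def equicorrelatedLaw (Q : Measure ℝ) (ρ : ℝ) : Measure (ℕ → ℝ) :=
  ENNReal.ofReal (1 - ρ) • Measure.infinitePi (fun _ : ℕ => Q) +
    ENNReal.ofReal ρ • Q.map (fun x _ => x)

/-- The counting process `N(t) = ∑_{n = 1}^M 1_{[0, t]}(X_n)`; the sequence `X_1, X_2, …` is indexed
from `0`. -/
def countingProcess {Ω : Type*} (M : Ω → ℕ) (X : ℕ → Ω → ℝ) (t : ℝ) (ω : Ω) : ℕ :=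
  ∑ n ∈ Finset.range (M ω), (Set.Icc (0 : ℝ) t).indicator (fun _ => 1) (X n ω)

/-- The probability mass function `k ↦ P(N(t) = k)` of the counting process, as a function on `ℤ`. -/
def countingPmf {Ω : Type*} [MeasurableSpace Ω] (P : Measure Ω) (M : Ω → ℕ) (X : ℕ → Ω → ℝ)
    (t : ℝ) (k : ℤ) : ℝ :=
  P.real {ω | (countingProcess M X t ω : ℤ) = k}

end

/-! ### The Caputo derivative -/

/-! Write F = (t/T)^{ν/α}. Conditioning on M and on the component of the mixture gives the
generating function of N(t): the independent component contributes E[(Fu + 1 - F)^M], the constant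
one F E[u^M] + 1 - F. Since 1 - (Fu + 1 - F) = F(1 - u) and T^ν F^α = t^ν, the first is E_{ν,1}(-λ^α
t^ν (1-u)^α). If q_k(t) is its coefficient of u^k (`spaceTimePoissonPmf`), uniqueness of
coefficients yields p_k(t) = (1-ρ) q_k(t) + ρ (F q_k(T) + (1-F) δ_{k0}), which is `countingPmf_eq`.

The series q_k(t) = ∑_r (-λ^α)^r (-1)^k C(αr, k) t^{νr} / Γ(νr+1) can be differentiated termwise
(`hasCaputoDerivAt_tsum`): the Caputo derivative kills the constant term and sends t^{νr}/Γ(νr+1) to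
t^{ν(r-1)}/Γ(ν(r-1)+1). After the shift of r, Vandermonde's identity for C(α + αr, k) turns the
result into -λ^α (I-B)^α q_k(t).

The remaining terms of p_k are a multiple of t^{ν/α}, whose derivative is a Beta integral, and a
constant. The equations follow on eliminating q through p_k(T) = q_k(T) and (I-B)^α δ_{k0} = (-1)^k
C(α,k). -/

theorem AbsolutelyContinuousOnInterval.congr {f g : ℝ → ℝ} {a b : ℝ}
    (hf : AbsolutelyContinuousOnInterval f a b) (hfg : Set.EqOn g f (Set.uIcc a b)) :
    AbsolutelyContinuousOnInterval g a b := by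
  rw [absolutelyContinuousOnInterval_iff] at hf ⊢
  intro ε hε
  obtain ⟨δ, hδ, h⟩ := hf ε hε
  refine ⟨δ, hδ, fun E hE hlen => (Finset.sum_congr rfl fun i hi => ?_).trans_lt (h E hE hlen)⟩
  rw [hfg (hE.1 i hi).1, hfg (hE.1 i hi).2]

/-- Absolute continuity comes for free: multiplying the integrand by the bounded factor (t-s)^ν
shows that f' itself is integrable, so f is f(0) plus the integral of f'. -/
theorem HasCaputoDerivAt.of_hasDerivAt {ν T t c : ℝ} {f f' : ℝ → ℝ} (hν : ν < 1) (hν0 : 0 < ν)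
    (ht : 0 < t)
    (hf : ContinuousOn f (Set.Icc 0 t)) (hf' : ∀ s ∈ Set.Ioo 0 t, HasDerivAt f (f' s) s)
    (hint : IntervalIntegrable (fun s => f' s / (t - s) ^ ν) volume 0 t)
    (hval : 1 / Real.Gamma (1 - ν) * ∫ s in (0 : ℝ)..t, f' s / (t - s) ^ ν = c) :
    HasCaputoDerivAt ν T f c t := by
  have heq : Set.EqOn (fun s => deriv f s / (t - s) ^ ν) (fun s => f' s / (t - s) ^ ν)
      (Set.Ioo 0 t) := fun s hs => by simp only [(hf' s hs).deriv]
  have hf'int : IntervalIntegrable f' volume 0 t := by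
    have hc : ContinuousOn (fun s : ℝ => (t - s) ^ ν) (Set.uIcc 0 t) :=
      (continuous_const.sub continuous_id).continuousOn.rpow_const fun _ _ => Or.inr hν0.le
    refine (hint.mul_continuousOn hc).congr_uIoo fun s hs => ?_
    rw [Set.uIoo_of_le ht.le] at hs
    exact div_mul_cancel₀ _ (Real.rpow_pos_of_pos (sub_pos.2 hs.2) ν).ne'
  rw [HasCaputoDerivAt, if_neg hν.ne]
  refine ⟨?_, fun s hs => (hf' s hs).differentiableAt.differentiableWithinAt, ?_, ?_⟩
  · have hac := hf'int.absolutelyContinuousOnInterval_intervalIntegral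
      (c := 0) (Set.left_mem_uIcc)
    have hconst : AbsolutelyContinuousOnInterval (fun _ : ℝ => f 0) 0 t :=
      contDiff_const.contDiffOn.absolutelyContinuousOnInterval
    refine (hac.add hconst).congr fun x hx => ?_
    rw [Set.uIcc_of_le ht.le] at hx
    have hsub : Set.uIcc 0 x ⊆ Set.uIcc 0 t := by
      rw [Set.uIcc_of_le ht.le, Set.uIcc_of_le hx.1]
      exact Set.Icc_subset_Icc_right hx.2
    have := intervalIntegral.integral_eq_sub_of_hasDerivAt_of_le hx.1
      (hf.mono (Set.Icc_subset_Icc_right hx.2)) (fun y hy => hf' y ⟨hy.1, hy.2.trans_le hx.2⟩)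
      (hf'int.mono_set hsub)
    simp [this]
  · refine hint.congr_uIoo fun s hs => ?_
    rw [Set.uIoo_of_le ht.le] at hs
    exact (heq hs).symm
  · rw [← hval, intervalIntegral.integral_congr_uIoo]
    rw [Set.uIoo_of_le ht.le]
    exact heq

theorem HasCaputoDerivAt.add {ν T t c d : ℝ} {f g : ℝ → ℝ} (ht : 0 < t)
    (hf : HasCaputoDerivAt ν T f c t) (hg : HasCaputoDerivAt ν T g d t) :
    HasCaputoDerivAt ν T (fun s => f s + g s) (c + d) t := by
  unfold HasCaputoDerivAt at *
  split_ifs at * with h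
  · exact hf.add hg
  · obtain ⟨hf1, hf2, hf3, hf4⟩ := hf
    obtain ⟨hg1, hg2, hg3, hg4⟩ := hg
    have heq : Set.EqOn (fun s => deriv f s / (t - s) ^ ν + deriv g s / (t - s) ^ ν)
        (fun s => deriv (fun s => f s + g s) s / (t - s) ^ ν) (Set.uIoo 0 t) := fun s hs => by
      rw [Set.uIoo_of_le ht.le] at hs
      have hn := isOpen_Ioo.mem_nhds hs
      simp only
      rw [deriv_fun_add ((hf2 s hs).differentiableAt hn) ((hg2 s hs).differentiableAt hn), add_div]
    refine ⟨hf1.add hg1, hf2.add hg2, (hf3.add hg3).congr_uIoo heq, ?_⟩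
    rw [← intervalIntegral.integral_congr_uIoo heq, intervalIntegral.integral_add hf3 hg3,
      mul_add, hf4, hg4]

theorem HasCaputoDerivAt.const_mul {ν T t c : ℝ} {f : ℝ → ℝ} (a : ℝ)
    (hf : HasCaputoDerivAt ν T f c t) :
    HasCaputoDerivAt ν T (fun s => a * f s) (a * c) t := by
  unfold HasCaputoDerivAt at *
  split_ifs at * with h
  · exact hf.const_mul a
  · obtain ⟨hf1, hf2, hf3, hf4⟩ := hf
    have heq : (fun s => deriv (fun s => a * f s) s / (t - s) ^ ν) =
        fun s => a * (deriv f s / (t - s) ^ ν) := by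
      ext s
      rw [deriv_const_mul_field, mul_div_assoc]
    refine ⟨hf1.const_mul a, hf2.const_mul a, heq ▸ hf3.const_mul a, ?_⟩
    rw [heq, intervalIntegral.integral_const_mul, mul_left_comm, hf4]

theorem hasCaputoDerivAt_const {ν T t : ℝ} (hν0 : 0 < ν) (hν : ν ≤ 1) (ht : 0 < t) (a : ℝ) :
    HasCaputoDerivAt ν T (fun _ => a) 0 t := by
  rcases hν.eq_or_lt with rfl | hν
  · rw [HasCaputoDerivAt, if_pos rfl]
    exact hasDerivWithinAt_const ..
  · exact .of_hasDerivAt (f' := fun _ => 0) hν hν0 ht continuousOn_const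
      (fun s _ => hasDerivAt_const s a) (by simp) (by simp)

theorem HasCaputoDerivAt.congr {ν T t c : ℝ} {f g : ℝ → ℝ} (ht : t ∈ Set.Ioc 0 T)
    (hf : HasCaputoDerivAt ν T f c t) (hfg : ∀ s ∈ Set.Icc 0 T, g s = f s) :
    HasCaputoDerivAt ν T g c t := by
  unfold HasCaputoDerivAt at *
  split_ifs at * with h
  · exact hf.congr hfg (hfg t ⟨ht.1.le, ht.2⟩)
  · obtain ⟨hf1, hf2, hf3, hf4⟩ := hf
    have hsub : Set.Ioo 0 t ⊆ Set.Icc 0 T := fun s hs => ⟨hs.1.le, hs.2.le.trans ht.2⟩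
    have heq : Set.EqOn (fun s => deriv f s / (t - s) ^ ν)
        (fun s => deriv g s / (t - s) ^ ν) (Set.uIoo 0 t) := fun s hs => by
      rw [Set.uIoo_of_le ht.1.le] at hs
      have : g =ᶠ[nhds s] f :=
        Filter.eventually_of_mem (isOpen_Ioo.mem_nhds hs) fun x hx => hfg x (hsub hx)
      simp only [this.deriv_eq]
    refine ⟨?_, hf2.congr fun s hs => hfg s (hsub hs), hf3.congr_uIoo heq, ?_⟩
    · refine hf1.congr fun s hs => ?_
      rw [Set.uIcc_of_le ht.1.le] at hs
      exact hfg s ⟨hs.1, hs.2.trans ht.2⟩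
    · rw [← intervalIntegral.integral_congr_uIoo heq, hf4]

/-! ### Powers -/

/-- This is the Beta integral B(β, 1-ν) rescaled to [0, t]. -/
theorem integral_rpow_div_rpow {β ν t : ℝ} (hβ : 0 < β) (hν : ν < 1) (ht : 0 < t) :
    IntervalIntegrable (fun s => s ^ (β - 1) / (t - s) ^ ν) volume 0 t ∧
    ∫ s in (0 : ℝ)..t, s ^ (β - 1) / (t - s) ^ ν =
      Real.Gamma β * Real.Gamma (1 - ν) / Real.Gamma (β - ν + 1) * t ^ (β - ν) := by
  have key : ∫ s in (0 : ℝ)..t, s ^ (β - 1) / (t - s) ^ ν =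
      Real.Gamma β * Real.Gamma (1 - ν) / Real.Gamma (β - ν + 1) * t ^ (β - ν) := by
    have h := Complex.betaIntegral_scaled (β : ℂ) ((1 - ν : ℝ) : ℂ) ht
    rw [Complex.betaIntegral_eq_Gamma_mul_div _ _ (by simpa) (by simpa)] at h
    apply Complex.ofReal_injective
    rw [← intervalIntegral.integral_ofReal]
    trans ∫ x in (0 : ℝ)..t, (x : ℂ) ^ ((β : ℂ) - 1) * ((t : ℂ) - x) ^ (((1 - ν : ℝ) : ℂ) - 1)
    · refine intervalIntegral.integral_congr fun s hs => ?_
      rw [Set.uIcc_of_le ht.le] at hs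
      have h1 : (0 : ℝ) ≤ t - s := sub_nonneg.2 hs.2
      simp only [Complex.ofReal_div, Complex.ofReal_cpow hs.1, Complex.ofReal_cpow h1]
      rw [div_eq_mul_inv, ← Complex.cpow_neg]
      congr 2 <;> push_cast <;> ring
    · rw [h]
      have e : (β : ℂ) + ((1 - ν : ℝ) : ℂ) = ((β - ν + 1 : ℝ) : ℂ) := by push_cast; ring
      rw [e, Complex.Gamma_ofReal, Complex.Gamma_ofReal, Complex.Gamma_ofReal,
        show ((β - ν + 1 : ℝ) : ℂ) - 1 = ((β - ν : ℝ) : ℂ) by push_cast; ring,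
        ← Complex.ofReal_cpow ht.le]
      push_cast
      ring
  -- The integral of a non-integrable function is 0 by convention, so a nonzero value proves
  -- integrability.
  refine ⟨intervalIntegral.intervalIntegrable_of_integral_ne_zero ?_, key⟩
  rw [key]
  have := Real.Gamma_pos_of_pos hβ
  have := Real.Gamma_pos_of_pos (sub_pos.2 hν)
  have := Real.Gamma_pos_of_pos (show 0 < β - ν + 1 by linarith)
  positivity

theorem hasCaputoDerivAt_rpow {ν T t β : ℝ} (hν0 : 0 < ν) (hν : ν ≤ 1) (ht : 0 < t) (hβ : 0 < β) :
    HasCaputoDerivAt ν T (fun s => s ^ β)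
      (Real.Gamma (β + 1) / Real.Gamma (β - ν + 1) * t ^ (β - ν)) t := by
  rcases hν.eq_or_lt with rfl | hν
  · rw [HasCaputoDerivAt, if_pos rfl]
    have h := (Real.hasDerivAt_rpow_const (p := β) (Or.inl ht.ne')).hasDerivWithinAt
      (s := Set.Icc 0 T)
    refine h.congr_deriv ?_
    rw [Real.Gamma_add_one hβ.ne', sub_add_cancel, mul_div_assoc,
      div_self (Real.Gamma_pos_of_pos hβ).ne', mul_one]
  · obtain ⟨h1, h2⟩ := integral_rpow_div_rpow hβ hν ht
    have e : (fun s : ℝ => β * s ^ (β - 1) / (t - s) ^ ν) =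
        fun s => β * (s ^ (β - 1) / (t - s) ^ ν) := by ext s; rw [mul_div_assoc]
    refine .of_hasDerivAt (f' := fun s => β * s ^ (β - 1)) hν hν0 ht
      (continuousOn_id.rpow_const fun _ _ => Or.inr hβ.le)
      (fun s hs => Real.hasDerivAt_rpow_const (Or.inl hs.1.ne')) (e ▸ h1.const_mul β) ?_
    rw [e, intervalIntegral.integral_const_mul, h2, Real.Gamma_add_one hβ.ne']
    have := (Real.Gamma_pos_of_pos (sub_pos.2 hν)).ne'
    field_simp

/-! ### Entire power series -/

theorem summable_abs_mul_pow {a : ℕ → ℝ} (ha : ∀ x : ℝ, Summable fun r => a r * x ^ r) (x : ℝ) :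
    Summable fun r => |a r| * |x| ^ r := by
  simpa [abs_mul, abs_pow] using (ha x).abs

/-- The factor r + 1 is at most 2^(r+1), so the series at 2(|x| + 1) dominates. -/
theorem summable_succ_mul_pow {a : ℕ → ℝ} (ha : ∀ x : ℝ, Summable fun r => a r * x ^ r) (x : ℝ) :
    Summable fun r : ℕ => ((r + 1) * a (r + 1)) * x ^ r := by
  have h := (summable_nat_add_iff 1).2 (summable_abs_mul_pow ha (2 * (|x| + 1)))
  refine h.of_norm_bounded fun r => ?_
  rw [Real.norm_eq_abs, abs_mul, abs_mul, abs_pow, abs_of_nonneg (by positivity : (0 : ℝ) ≤ r + 1),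
    abs_of_nonneg (by positivity : 0 ≤ 2 * (|x| + 1)), mul_pow]
  have h1 : (r + 1 : ℝ) ≤ 2 ^ (r + 1) := by exact_mod_cast Nat.lt_two_pow_self.le
  have h2 : |x| ^ r ≤ (|x| + 1) ^ (r + 1) :=
    (pow_le_pow_left₀ (abs_nonneg x) (by linarith) r).trans
      (pow_le_pow_right₀ (by linarith [abs_nonneg x]) (Nat.le_succ r))
  calc (r + 1 : ℝ) * |a (r + 1)| * |x| ^ r = |a (r + 1)| * ((r + 1) * |x| ^ r) := by ring
    _ ≤ _ := by gcongr

theorem hasDerivAt_tsum_mul_pow {a : ℕ → ℝ} (ha : ∀ x : ℝ, Summable fun r => a r * x ^ r) (x : ℝ) :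
    HasDerivAt (fun y => ∑' r, a r * y ^ r) (∑' r : ℕ, ((r + 1) * a (r + 1)) * x ^ r) x := by
  have hs := summable_abs_mul_pow (summable_succ_mul_pow ha) (|x| + 1)
  rw [abs_of_nonneg (by positivity)] at hs
  have hx : x ∈ Metric.ball (0 : ℝ) (|x| + 1) := by simp
  have hsh : (fun y => ∑' r, a r * y ^ r) = fun y => a 0 + ∑' r, a (r + 1) * y ^ (r + 1) := by
    ext y
    rw [(ha y).tsum_eq_zero_add, pow_zero, mul_one]
  rw [hsh]
  refine (hasDerivAt_tsum_of_isPreconnected (g := fun r y => a (r + 1) * y ^ (r + 1))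
    (g' := fun r y => ((r + 1) * a (r + 1)) * y ^ r) hs Metric.isOpen_ball
    (convex_ball 0 _).isPreconnected (fun r y _ => ?_) (fun r y hy => ?_) hx
    ((summable_nat_add_iff 1).2 (ha x)) hx).const_add (a 0)
  · refine ((hasDerivAt_pow (r + 1) y).const_mul (a (r + 1))).congr_deriv ?_
    rw [add_tsub_cancel_right]
    push_cast
    ring
  · rw [Real.norm_eq_abs, abs_mul, abs_pow]
    have : |y| ≤ |x| + 1 := by simpa using (Metric.mem_ball.1 hy).le
    gcongr

theorem continuous_tsum_mul_pow {a : ℕ → ℝ} (ha : ∀ x : ℝ, Summable fun r => a r * x ^ r) :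
    Continuous fun y => ∑' r, a r * y ^ r :=
  continuous_iff_continuousAt.2 fun x => (hasDerivAt_tsum_mul_pow ha x).continuousAt

/-! ### Mittag-Leffler type series -/

/-- Keep only the part of the Gamma integral over (A, A+1]. As A is arbitrary, Γ(νr+1) outgrows
every geometric sequence. -/
theorem exp_mul_rpow_le_Gamma {A x : ℝ} (hA : 0 < A) (hx : 0 ≤ x) :
    Real.exp (-(A + 1)) * A ^ x ≤ Real.Gamma (x + 1) := by
  rw [Real.Gamma_eq_integral (by linarith)]
  have hi := Real.GammaIntegral_convergent (show 0 < x + 1 by linarith)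
  have hsub : Set.Ioc A (A + 1) ⊆ Set.Ioi 0 := fun y hy => hA.trans hy.1
  calc Real.exp (-(A + 1)) * A ^ x
      = ∫ _ in Set.Ioc A (A + 1), Real.exp (-(A + 1)) * A ^ x := by simp
    _ ≤ ∫ y in Set.Ioc A (A + 1), Real.exp (-y) * y ^ (x + 1 - 1) := by
        refine setIntegral_mono_on (integrable_const _) (hi.mono_set hsub) measurableSet_Ioc fun y hy => ?_
        rw [add_sub_cancel_right]
        have := hy.1.le
        have := hy.2
        gcongr
    _ ≤ _ := by
        refine setIntegral_mono_set hi ?_ hsub.eventuallyLE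
        filter_upwards [ae_restrict_mem measurableSet_Ioi] with y hy
        have : 0 < y := hy
        positivity

theorem summable_pow_div_Gamma {ν : ℝ} (hν : 0 < ν) (x : ℝ) :
    Summable fun r : ℕ => x ^ r / Real.Gamma (ν * r + 1) := by
  -- R makes |x|/R < 1, and A is chosen so that A^(νr) = R^r.
  set R : ℝ := 2 * |x| + 1
  have hR : 0 < R := by positivity
  set A : ℝ := R ^ (1 / ν)
  have hA : 0 < A := by positivity
  have hgeo : Summable fun r : ℕ => Real.exp (A + 1) * (|x| / R) ^ r := by
    refine (summable_geometric_of_lt_one (by positivity) ?_).mul_left _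
    rw [div_lt_one hR]
    linarith [abs_nonneg x]
  refine hgeo.of_norm_bounded fun r => ?_
  have h := exp_mul_rpow_le_Gamma hA (show 0 ≤ ν * r by positivity)
  have hAR : A ^ (ν * r) = R ^ r := by
    rw [← Real.rpow_mul hR.le, ← mul_assoc, one_div_mul_cancel hν.ne', one_mul, Real.rpow_natCast]
  rw [hAR] at h
  have hG : 0 < Real.Gamma (ν * r + 1) := Real.Gamma_pos_of_pos (by positivity)
  rw [Real.norm_eq_abs, abs_div, abs_of_pos hG, abs_pow, div_pow, div_le_iff₀ hG]
  calc |x| ^ r = Real.exp (A + 1) * (|x| ^ r / R ^ r) * (Real.exp (-(A + 1)) * R ^ r) := by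
        rw [Real.exp_neg]; field_simp
    _ ≤ _ := by gcongr

theorem summable_mul_pow_div_Gamma {ν B K : ℝ} {c : ℕ → ℝ} (hν : 0 < ν)
    (hc : ∀ r, |c r| ≤ B * K ^ r) (x : ℝ) :
    Summable fun r : ℕ => c r / Real.Gamma (ν * r + 1) * x ^ r := by
  refine ((summable_pow_div_Gamma hν (K * |x|)).mul_left B).of_norm_bounded fun r => ?_
  have hG : 0 < Real.Gamma (ν * r + 1) := Real.Gamma_pos_of_pos (by positivity)
  rw [Real.norm_eq_abs, abs_mul, abs_div, abs_of_pos hG, abs_pow, mul_pow]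
  calc |c r| / Real.Gamma (ν * r + 1) * |x| ^ r
      ≤ B * K ^ r / Real.Gamma (ν * r + 1) * |x| ^ r := by gcongr; exact hc r
    _ = _ := by ring

/-- The function is an entire series in s^ν, so f' comes from the chain rule; the sum and the
singular integral are then exchanged, each term being a Beta integral. -/
theorem hasCaputoDerivAt_tsum {ν T t B K : ℝ} {c : ℕ → ℝ} (hν0 : 0 < ν) (hν : ν ≤ 1) (ht : 0 < t)
    (hc : ∀ r, |c r| ≤ B * K ^ r) :
    HasCaputoDerivAt ν T (fun s => ∑' r : ℕ, c r / Real.Gamma (ν * r + 1) * (s ^ ν) ^ r)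
      (∑' r : ℕ, c (r + 1) / Real.Gamma (ν * r + 1) * (t ^ ν) ^ r) t := by
  have ha := summable_mul_pow_div_Gamma hν0 hc
  -- By Γ(z+1) = zΓ(z); the 1/ν left over cancels the ν in the derivative of s^ν.
  have hcoef (r : ℕ) : (r + 1) * (c (r + 1) / Real.Gamma (ν * (r + 1 : ℕ) + 1)) =
      c (r + 1) / Real.Gamma (ν * r + ν) / ν := by
    have h1 : ν * r + ν ≠ 0 := by positivity
    have h2 := (Real.Gamma_pos_of_pos (show 0 < ν * r + ν by positivity)).ne'
    have h3 : (r + 1 : ℝ) ≠ 0 := by positivity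
    push_cast
    rw [show ν * (r + 1 : ℝ) + 1 = ν * r + ν + 1 by ring, Real.Gamma_add_one h1,
      show ν * r + ν = ν * (r + 1) by ring]
    rw [show ν * r + ν = ν * (r + 1) by ring] at h2
    field_simp
  have hds := summable_succ_mul_pow ha
  have hd := hasDerivAt_tsum_mul_pow ha
  have hcont := continuous_tsum_mul_pow hds
  simp only [hcoef] at hds hd hcont
  rcases hν.eq_or_lt with rfl | hν
  · rw [HasCaputoDerivAt, if_pos rfl]
    simpa using (hd t).hasDerivWithinAt
  set g : ℝ → ℝ := fun x => ∑' r : ℕ, c (r + 1) / Real.Gamma (ν * r + ν) / ν * x ^ r with hg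
  have hpow : ContinuousOn (fun s : ℝ => s ^ ν) (Set.uIcc 0 t) :=
    continuousOn_id.rpow_const fun _ _ => Or.inr hν0.le
  obtain ⟨hI, -⟩ := integral_rpow_div_rpow hν0 hν ht
  refine .of_hasDerivAt (f' := fun s => g (s ^ ν) * (ν * s ^ (ν - 1))) hν hν0 ht ?_ ?_ ?_ ?_
  · rw [← Set.uIcc_of_le ht.le]
    exact (continuous_tsum_mul_pow ha).comp_continuousOn hpow
  · exact fun s hs => HasDerivAt.comp (h₂ := fun y => ∑' r : ℕ, c r / Real.Gamma (ν * r + 1) * y ^ r)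
      s (hd (s ^ ν)) (Real.hasDerivAt_rpow_const (Or.inl hs.1.ne'))
  · refine ((hI.continuousOn_mul (hcont.comp_continuousOn hpow)).const_mul ν).congr_uIoo
      fun s _ => ?_
    simp only [Function.comp_apply]
    ring
  · set F : ℕ → ℝ → ℝ := fun r s =>
      c (r + 1) / Real.Gamma (ν * r + ν) * (s ^ (ν * r + ν - 1) / (t - s) ^ ν) with hF
    have hβ (r : ℕ) : 0 < ν * r + ν := by positivity
    have hFI (r : ℕ) : Integrable (F r) (volume.restrict (Set.Ioc 0 t)) :=
      ((intervalIntegrable_iff_integrableOn_Ioc_of_le ht.le).1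
        (integral_rpow_div_rpow (hβ r) hν ht).1).const_mul _
    have hval (r : ℕ) : ∫ s in Set.Ioc 0 t, s ^ (ν * r + ν - 1) / (t - s) ^ ν =
        Real.Gamma (ν * r + ν) * Real.Gamma (1 - ν) / Real.Gamma (ν * r + 1) * (t ^ ν) ^ r := by
      rw [← intervalIntegral.integral_of_le ht.le, (integral_rpow_div_rpow (hβ r) hν ht).2,
        add_sub_cancel_right, Real.rpow_mul_natCast ht.le]
    have hF1 (r : ℕ) : ∫ s in Set.Ioc 0 t, F r s = Real.Gamma (1 - ν) *
        (c (r + 1) / Real.Gamma (ν * r + 1) * (t ^ ν) ^ r) := by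
      rw [hF]
      simp only
      rw [integral_const_mul, hval]
      have := (Real.Gamma_pos_of_pos (hβ r)).ne'
      field_simp
    have hF2 (r : ℕ) : ∫ s in Set.Ioc 0 t, ‖F r s‖ = Real.Gamma (1 - ν) *
        |c (r + 1) / Real.Gamma (ν * r + 1) * (t ^ ν) ^ r| := by
      have : ∫ s in Set.Ioc 0 t, ‖F r s‖ = ∫ s in Set.Ioc 0 t,
          |c (r + 1)| / Real.Gamma (ν * r + ν) * (s ^ (ν * r + ν - 1) / (t - s) ^ ν) := by
        refine setIntegral_congr_fun measurableSet_Ioc fun s hs => ?_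
        have h1 := Real.Gamma_pos_of_pos (hβ r)
        have h2 : 0 < s := hs.1
        have h3 : 0 ≤ t - s := sub_nonneg.2 hs.2
        simp only [hF, Real.norm_eq_abs, abs_mul, abs_div, abs_of_pos h1]
        rw [abs_of_nonneg (by positivity : 0 ≤ s ^ (ν * r + ν - 1)),
          abs_of_nonneg (by positivity : 0 ≤ (t - s) ^ ν)]
      rw [this, integral_const_mul, hval, abs_mul, abs_div,
        abs_of_pos (Real.Gamma_pos_of_pos (show 0 < ν * r + 1 by positivity)),
        abs_of_nonneg (by positivity : 0 ≤ (t ^ ν) ^ r)]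
      have := (Real.Gamma_pos_of_pos (hβ r)).ne'
      field_simp
    have hc' (r : ℕ) : |c (r + 1)| ≤ B * K * K ^ r := by
      rw [mul_assoc, ← pow_succ']
      exact hc (r + 1)
    have hsum := summable_mul_pow_div_Gamma (c := fun r => c (r + 1)) hν0 hc' (t ^ ν)
    -- The L¹ norms of the terms are, up to Γ(1-ν), the absolute values of the terms of the
    -- convergent limit series.
    have hswap := integral_tsum_of_summable_integral_norm hFI
      (by simpa only [hF2] using hsum.abs.mul_left (Real.Gamma (1 - ν)))
    simp only [hF1] at hswap
    rw [tsum_mul_left] at hswap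
    rw [intervalIntegral.integral_of_le ht.le, one_div,
      inv_mul_eq_iff_eq_mul₀ (Real.Gamma_pos_of_pos (sub_pos.2 hν)).ne', hswap]
    refine setIntegral_congr_fun measurableSet_Ioc fun s hs => ?_
    have hs0 : 0 < s := hs.1
    simp only [hg, hF]
    rw [← tsum_mul_right, ← tsum_div_const]
    refine tsum_congr fun r => ?_
    rw [show ν * r + ν - 1 = ν * r + (ν - 1) by ring, Real.rpow_add hs0,
      Real.rpow_mul_natCast hs0.le]
    field_simp

/-! ### Generalized binomial coefficients -/

theorem Ring.succ_mul_choose_succ (a : ℝ) (n : ℕ) :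
    (n + 1) * Ring.choose a (n + 1) = (a - n) * Ring.choose a n := by
  rw [Ring.choose_eq_smul, Ring.choose_eq_smul, descPochhammer_succ_right, Polynomial.smeval_mul,
    Polynomial.smeval_sub, Polynomial.smeval_X, Polynomial.smeval_natCast, Nat.factorial_succ]
  push_cast
  simp only [smul_eq_mul, nsmul_eq_mul, pow_one, pow_zero, mul_one]
  field_simp

theorem Ring.succ_mul_multichoose_succ (a : ℝ) (n : ℕ) :
    (n + 1) * Ring.multichoose a (n + 1) = (a + n) * Ring.multichoose a n := by
  have h := Ring.factorial_nsmul_multichoose_eq_ascPochhammer a (n + 1)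
  rw [ascPochhammer_succ_right, Polynomial.smeval_mul, Polynomial.smeval_add, Polynomial.smeval_X,
    Polynomial.smeval_natCast, ← Ring.factorial_nsmul_multichoose_eq_ascPochhammer,
    Nat.factorial_succ] at h
  simp only [nsmul_eq_mul, pow_one, pow_zero, mul_one] at h
  push_cast at h
  have hn : (n.factorial : ℝ) ≠ 0 := by positivity
  apply mul_left_cancel₀ hn
  linarith

theorem Ring.multichoose_nonneg {a : ℝ} (ha : 0 ≤ a) (n : ℕ) : 0 ≤ Ring.multichoose a n := by
  induction n with
  | zero => simp
  | succ n ih =>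
    have h := Ring.succ_mul_multichoose_succ a n
    have h1 : 0 ≤ (n + 1 : ℝ) * Ring.multichoose a (n + 1) := h ▸ by positivity
    exact nonneg_of_mul_nonneg_right h1 (by positivity)

/-- The one-step recursions have factors a - n and a + n, and |a - n| ≤ a + n. -/
theorem Ring.abs_choose_le_multichoose {a : ℝ} (ha : 0 ≤ a) (n : ℕ) :
    |Ring.choose a n| ≤ Ring.multichoose a n := by
  induction n with
  | zero => simp
  | succ n ih =>
    have h1 := congrArg abs (Ring.succ_mul_choose_succ a n)
    have h2 := Ring.succ_mul_multichoose_succ a n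
    have hn : (0 : ℝ) < n + 1 := by positivity
    rw [abs_mul, abs_mul, abs_of_pos hn] at h1
    have h3 : |a - n| ≤ a + n := abs_le.2 ⟨by linarith [Nat.cast_nonneg (α := ℝ) n], by
      linarith [Nat.cast_nonneg (α := ℝ) n]⟩
    refine le_of_mul_le_mul_left ?_ hn
    rw [h1, h2]
    gcongr

theorem Real.hasSum_choose_mul_pow (a : ℝ) {u : ℝ} (hu : |u| < 1) :
    HasSum (fun k : ℕ => Ring.choose a k * u ^ k) ((1 + u) ^ a) := by
  have h := (Real.one_add_rpow_hasFPowerSeriesOnBall_zero (a := a)).hasSum (y := u)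
    (by simpa [enorm_eq_nnnorm, ← NNReal.coe_lt_coe] using hu)
  simpa [binomialSeries, mul_comm] using h

theorem Real.hasSum_multichoose_mul_pow (a : ℝ) {u : ℝ} (hu : |u| < 1) :
    HasSum (fun k : ℕ => Ring.multichoose a k * u ^ k) (((1 - u) ^ a)⁻¹) := by
  have h := (Real.one_div_one_sub_rpow_hasFPowerSeriesOnBall_zero a).hasSum (y := u)
    (by simpa [enorm_eq_nnnorm, ← NNReal.coe_lt_coe] using hu)
  simpa [Ring.multichoose_eq, mul_comm] using h

/-- A single term of the nonnegative expansion of (1-u)^(-a) at u = 1/2 is at most the sum 2^a ≤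
2^r. With a = αr this is the growth, geometric in r, that termwise differentiation needs. -/
theorem Ring.abs_choose_le_two_pow {a : ℝ} {r : ℕ} (ha : 0 ≤ a) (har : a ≤ r) (k : ℕ) :
    |Ring.choose a k| ≤ 2 ^ k * 2 ^ r := by
  have hs := Real.hasSum_multichoose_mul_pow a (u := 1 / 2) (by norm_num [abs_of_pos])
  have h1 := le_hasSum hs k fun j _ => mul_nonneg (Ring.multichoose_nonneg ha j) (by positivity)
  have h2 : (((1 : ℝ) - 1 / 2) ^ a)⁻¹ ≤ 2 ^ r := by
    rw [show (1 : ℝ) - 1 / 2 = 2⁻¹ by norm_num, Real.inv_rpow (by norm_num), inv_inv,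
      ← Real.rpow_natCast]
    exact Real.rpow_le_rpow_of_exponent_le (by norm_num) har
  have h3 := Ring.abs_choose_le_multichoose ha k
  have h4 : Ring.multichoose a k * (1 / 2) ^ k ≤ 2 ^ r := h1.trans h2
  rw [one_div, inv_pow, mul_inv_le_iff₀ (by positivity)] at h4
  linarith

/-! ### The space-time fractional Poisson distribution -/

/-- The coefficient of `u ^ k` in the expansion of `E_{ν,1}(-λ^α t^ν (1 - u)^α)`. -/
noncomputable def spaceTimePoissonPmf (α ν lam t : ℝ) (k : ℕ) : ℝ :=
  ∑' r : ℕ, (-lam ^ α) ^ r * ((-1) ^ k * Ring.choose (α * r) k) / Real.Gamma (ν * r + 1)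
    * (t ^ ν) ^ r

section
variable {α ν lam t : ℝ}

theorem abs_spaceTimePoisson_coeff_le (hα : α ∈ Set.Ioc (0 : ℝ) 1) (lam : ℝ) (k r : ℕ) :
    |(-lam ^ α) ^ r * ((-1) ^ k * Ring.choose (α * r) k)| ≤ 2 ^ k * (|lam ^ α| * 2) ^ r := by
  have h := Ring.abs_choose_le_two_pow (a := α * r) (r := r) (k := k)
    (mul_nonneg hα.1.le r.cast_nonneg) (mul_le_of_le_one_left r.cast_nonneg hα.2)
  rw [abs_mul, abs_mul, abs_pow, abs_pow, abs_neg, abs_neg, abs_one, one_pow, one_mul, mul_pow]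
  calc |lam ^ α| ^ r * |Ring.choose (α * r) k| ≤ |lam ^ α| ^ r * (2 ^ k * 2 ^ r) := by gcongr
    _ = _ := by ring

theorem summable_spaceTimePoisson (hα : α ∈ Set.Ioc (0 : ℝ) 1) (hν : 0 < ν) (lam x : ℝ) (k : ℕ) :
    Summable fun r : ℕ => (-lam ^ α) ^ r * ((-1) ^ k * Ring.choose (α * r) k)
      / Real.Gamma (ν * r + 1) * x ^ r :=
  summable_mul_pow_div_Gamma hν (abs_spaceTimePoisson_coeff_le hα lam k) x

/-- Expand each (1-u)^{αr} binomially and exchange the two sums. -/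
theorem hasSum_spaceTimePoissonPmf_mul_pow (hα : α ∈ Set.Ioc (0 : ℝ) 1) (hν : 0 < ν)
    (hlam : 0 < lam) (ht : 0 ≤ t) {u : ℝ} (hu : u ∈ Set.Ico (0 : ℝ) 1) :
    HasSum (fun k => spaceTimePoissonPmf α ν lam t k * u ^ k)
      (mittagLeffler ν 1 (-(lam ^ α * t ^ ν * (1 - u) ^ α))) := by
  set d : ℕ → ℝ := fun r => (-(lam ^ α * t ^ ν)) ^ r / Real.Gamma (ν * r + 1)
  set G : ℕ × ℕ → ℝ := fun p => d p.1 * (Ring.choose (α * p.1) p.2 * (-u) ^ p.2) with hG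
  have hu1 : |u| < 1 := by rw [abs_of_nonneg hu.1]; exact hu.2
  have hu2 : 0 < 1 - u := sub_pos.2 hu.2
  -- The majorant replaces C(αr, k)(-u)^k by the coefficients of (1-u)^{-αr}; its row sums again
  -- form a Mittag-Leffler series.
  have hbound : Summable fun p : ℕ × ℕ => |d p.1| * (Ring.multichoose (α * p.1) p.2 * u ^ p.2) := by
    have hk (r : ℕ) := (Real.hasSum_multichoose_mul_pow (α * r) hu1).mul_left |d r|
    rw [summable_prod_of_nonneg]
    · refine ⟨fun r => (hk r).summable, ?_⟩
      simp only [(hk _).tsum_eq]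
      refine (summable_pow_div_Gamma hν (lam ^ α * t ^ ν * ((1 - u) ^ α)⁻¹)).congr fun r => ?_
      rw [Real.rpow_mul_natCast hu2.le, abs_div, abs_pow, abs_neg,
        abs_of_nonneg (by positivity : 0 ≤ lam ^ α * t ^ ν),
        abs_of_pos (Real.Gamma_pos_of_pos (by positivity : 0 < ν * r + 1)), mul_pow _ _⁻¹, inv_pow]
      ring
    · exact fun p => mul_nonneg (abs_nonneg _)
        (mul_nonneg (Ring.multichoose_nonneg (mul_nonneg hα.1.le p.1.cast_nonneg) _)
          (pow_nonneg hu.1 _))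
  have hGs : Summable G := by
    refine hbound.of_norm_bounded fun p => ?_
    rw [Real.norm_eq_abs, abs_mul, abs_mul, abs_pow, abs_neg, abs_of_nonneg hu.1]
    have := Ring.abs_choose_le_multichoose (mul_nonneg hα.1.le p.1.cast_nonneg) p.2
    have := hu.1
    gcongr
  have hr (r : ℕ) : HasSum (fun k => G (r, k)) (d r * ((1 - u) ^ α) ^ r) := by
    have h := (Real.hasSum_choose_mul_pow (α * r) (u := -u) (by rwa [abs_neg])).mul_left (d r)
    rwa [← sub_eq_add_neg, Real.rpow_mul_natCast hu2.le] at h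
  have hk (k : ℕ) : HasSum (fun r => G (r, k)) (spaceTimePoissonPmf α ν lam t k * u ^ k) := by
    have h := (summable_spaceTimePoisson hα hν lam (t ^ ν) k).hasSum.mul_right (u ^ k)
    refine h.congr_fun fun r => ?_
    simp only [hG, d]
    rw [neg_pow u, ← neg_mul, mul_pow]
    ring
  have h1 := hGs.hasSum.prod_fiberwise hr
  have h2 := ((Equiv.prodComm ℕ ℕ).hasSum_iff.2 hGs.hasSum).prod_fiberwise hk
  have h3 : mittagLeffler ν 1 (-(lam ^ α * t ^ ν * (1 - u) ^ α)) = ∑' p, G p := by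
    rw [← h1.tsum_eq, mittagLeffler]
    refine tsum_congr fun r => ?_
    rw [← neg_mul, mul_pow]
    ring
  rwa [h3]

theorem fracDiff_eq_sum {f : ℤ → ℝ} (hf : ∀ k < 0, f k = 0) (α : ℝ) (k : ℕ) :
    fracDiff α f k = ∑ ij ∈ Finset.HasAntidiagonal.antidiagonal k,
      (-1) ^ ij.1 * Ring.choose α ij.1 * f (ij.2 : ℕ) := by
  rw [Finset.Nat.sum_antidiagonal_eq_sum_range_succ
    (fun i j => (-1) ^ i * Ring.choose α i * f (j : ℕ)), fracDiff, tsum_eq_sum]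
  · refine Finset.sum_congr rfl fun j hj => ?_
    rw [Nat.cast_sub (by simpa [Nat.lt_succ_iff] using hj)]
  · intro j hj
    rw [hf, mul_zero]
    simp at hj
    omega

theorem hasCaputoDerivAt_spaceTimePoissonPmf {T : ℝ} (hα : α ∈ Set.Ioc (0 : ℝ) 1) (hν0 : 0 < ν)
    (hν : ν ≤ 1) (ht : 0 < t) (k : ℕ) :
    HasCaputoDerivAt ν T (fun s => spaceTimePoissonPmf α ν lam s k)
      (-lam ^ α * ∑ ij ∈ Finset.HasAntidiagonal.antidiagonal k,
        (-1) ^ ij.1 * Ring.choose α ij.1 * spaceTimePoissonPmf α ν lam t ij.2) t := by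
  have h := hasCaputoDerivAt_tsum (T := T) hν0 hν ht (abs_spaceTimePoisson_coeff_le hα lam k)
  suffices hval : -lam ^ α * ∑ ij ∈ Finset.HasAntidiagonal.antidiagonal k,
      (-1) ^ ij.1 * Ring.choose α ij.1 * spaceTimePoissonPmf α ν lam t ij.2 =
      ∑' r : ℕ, (-lam ^ α) ^ (r + 1) * ((-1) ^ k * Ring.choose (α * (r + 1 : ℕ)) k)
        / Real.Gamma (ν * r + 1) * (t ^ ν) ^ r by
    rw [hval]
    exact h
  have hs (j : ℕ) := summable_spaceTimePoisson hα hν0 lam (t ^ ν) j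
  have hsum : HasSum _ (-lam ^ α * ∑ ij ∈ Finset.HasAntidiagonal.antidiagonal k,
      (-1) ^ ij.1 * Ring.choose α ij.1 * spaceTimePoissonPmf α ν lam t ij.2) :=
    (hasSum_sum fun ij _ =>
      (hs ij.2).hasSum.mul_left ((-1) ^ ij.1 * Ring.choose α ij.1)).mul_left (-lam ^ α)
  rw [← hsum.tsum_eq]
  refine tsum_congr fun r => ?_
  -- Vandermonde's identity splits C(α + αr, k) into the coefficients of (I-B)^α and those of q_j.
  rw [show α * ((r + 1 : ℕ) : ℝ) = α + α * r by push_cast; ring,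
    Ring.add_choose_eq k (Commute.all _ _), Finset.mul_sum, Finset.mul_sum, Finset.mul_sum,
    Finset.sum_div, Finset.sum_mul]
  refine Finset.sum_congr rfl fun ij hij => ?_
  have hk : (-1 : ℝ) ^ k = (-1) ^ ij.1 * (-1) ^ ij.2 := by
    rw [← pow_add, Finset.HasAntidiagonal.mem_antidiagonal.1 hij]
  rw [hk, pow_succ]
  ring

end

/-! ### Uniqueness of power series coefficients -/

/-- The difference series is analytic at 0 and vanishes on (0, 1), which accumulates at 0, so the
identity theorem applies. -/
theorem eq_of_hasSum_mul_pow_eq {a b : ℕ → ℝ} {f : ℝ → ℝ}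
    (ha : ∀ u ∈ Set.Ico (0 : ℝ) 1, HasSum (fun k => a k * u ^ k) (f u))
    (hb : ∀ u ∈ Set.Ico (0 : ℝ) 1, HasSum (fun k => b k * u ^ k) (f u)) : a = b := by
  have hc : ∀ u ∈ Set.Ico (0 : ℝ) 1, HasSum (fun k => (a k - b k) * u ^ k) 0 := fun u hu => by
    simpa [sub_mul] using (ha u hu).sub (hb u hu)
  set p : FormalMultilinearSeries ℝ ℝ ℝ := .ofScalars ℝ fun k => a k - b k
  set g : ℝ → ℝ := fun z => ∑' k, (a k - b k) * z ^ k with hg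
  have hp : HasFPowerSeriesAt g p 0 := by
    rw [hasFPowerSeriesAt_iff]
    filter_upwards [Metric.ball_mem_nhds (0 : ℝ) one_pos] with z hz
    have hz : |z| < 1 := by simpa using hz
    -- Convergence is only given for nonnegative arguments; absolute convergence at |z| covers
    -- negative z.
    have hs := (hc |z| ⟨abs_nonneg z, hz⟩).summable.abs
    have : Summable fun k => (a k - b k) * z ^ k :=
      .of_abs (by simpa [abs_mul] using hs)
    simpa [p, hg, mul_comm] using this.hasSum
  have hfreq : ∃ᶠ z in nhdsWithin (0 : ℝ) {0}ᶜ, g z = 0 := by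
    have : ∃ᶠ z in nhdsWithin (0 : ℝ) (Set.Ioi 0), g z = 0 := by
      refine Filter.Eventually.frequently ?_
      filter_upwards [Ioo_mem_nhdsGT one_pos] with z hz
      exact (hc z ⟨hz.1.le, hz.2⟩).tsum_eq
    exact this.filter_mono (nhdsWithin_mono _ fun z hz => (ne_of_gt hz : z ≠ 0))
  have hzero := (hp.analyticAt.frequently_zero_iff_eventually_zero).1 hfreq
  have hp0 : p = 0 := HasFPowerSeriesAt.eq_zero (hp.congr hzero)
  ext k
  have : p.coeff k = 0 := by rw [hp0]; rfl
  simpa [p, sub_eq_zero] using this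

/-! ### The generating function of the counting process -/

section
variable {u t : ℝ}

/-- The factor contributed by one arrival time to the generating function of the counting
process. -/
noncomputable def arrivalFactor (u t x : ℝ) : ℝ :=
  u ^ (Set.Icc (0 : ℝ) t).indicator (fun _ => 1) x

/-- The exponent is 0 or 1, so every power is affine in the indicator, which gives measurability and
the moments. -/
theorem arrivalFactor_pow (u t x : ℝ) (m : ℕ) :
    arrivalFactor u t x ^ m = 1 + (u ^ m - 1) * (Set.Icc (0 : ℝ) t).indicator 1 x := by
  by_cases h : x ∈ Set.Icc 0 t <;> simp [arrivalFactor, h]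

theorem arrivalFactor_mem_Icc (hu : u ∈ Set.Icc (0 : ℝ) 1) (t x : ℝ) :
    arrivalFactor u t x ∈ Set.Icc (0 : ℝ) 1 :=
  ⟨pow_nonneg hu.1 _, pow_le_one₀ hu.1 hu.2⟩

theorem measurable_arrivalFactor (u t : ℝ) : Measurable (arrivalFactor u t) := by
  have : arrivalFactor u t = fun x => 1 + (u - 1) * (Set.Icc (0 : ℝ) t).indicator 1 x := by
    ext x
    simpa using arrivalFactor_pow u t x 1
  rw [this]
  exact ((measurable_one.indicator measurableSet_Icc).const_mul _).const_add _

theorem pow_countingProcess {Ω : Type*} (M : Ω → ℕ) (X : ℕ → Ω → ℝ) (u t : ℝ) (ω : Ω) :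
    u ^ countingProcess M X t ω = ∏ n ∈ Finset.range (M ω), arrivalFactor u t (X n ω) :=
  (Finset.prod_pow_eq_pow_sum _ _ _).symm

theorem integral_arrivalFactor_pow (Q : Measure ℝ) [IsProbabilityMeasure Q] (u t : ℝ) (m : ℕ) :
    ∫ x, arrivalFactor u t x ^ m ∂Q = Q.real (Set.Icc 0 t) * u ^ m + (1 - Q.real (Set.Icc 0 t)) := by
  have hi : Integrable ((Set.Icc (0 : ℝ) t).indicator (1 : ℝ → ℝ)) Q :=
    (integrable_const (1 : ℝ)).indicator measurableSet_Icc
  simp only [arrivalFactor_pow]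
  rw [integral_add (integrable_const _) (hi.const_mul _), integral_const_mul,
    integral_indicator_one measurableSet_Icc]
  simp
  ring

theorem measurable_prod_arrivalFactor (u t : ℝ) (m : ℕ) :
    Measurable fun x : ℕ → ℝ => ∏ n ∈ Finset.range m, arrivalFactor u t (x n) :=
  Finset.measurable_fun_prod _ fun n _ => (measurable_arrivalFactor u t).comp (measurable_pi_apply n)

theorem norm_prod_arrivalFactor_le (hu : u ∈ Set.Icc (0 : ℝ) 1) (t : ℝ) (m : ℕ) (x : ℕ → ℝ) :
    ‖∏ n ∈ Finset.range m, arrivalFactor u t (x n)‖ ≤ 1 := by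
  have h := fun n => arrivalFactor_mem_Icc hu t (x n)
  rw [Real.norm_eq_abs, abs_of_nonneg (Finset.prod_nonneg fun n _ => (h n).1)]
  exact Finset.prod_le_one (fun n _ => (h n).1) fun n _ => (h n).2

theorem integral_prod_arrivalFactor_infinitePi (Q : Measure ℝ) [IsProbabilityMeasure Q] (u t : ℝ)
    (m : ℕ) :
    ∫ x, ∏ n ∈ Finset.range m, arrivalFactor u t (x n) ∂Measure.infinitePi (fun _ : ℕ => Q) =
      (Q.real (Set.Icc 0 t) * u + (1 - Q.real (Set.Icc 0 t))) ^ m := by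
  have hφ := measurable_arrivalFactor u t
  have hind := (iIndepFun_infinitePi (P := fun _ : ℕ => Q) (X := fun _ => arrivalFactor u t)
    fun _ => hφ).precomp (Fin.val_injective (n := m))
  have h := hind.integral_fun_prod_eq_prod_integral
    fun i => (hφ.comp (measurable_pi_apply (i : ℕ))).aestronglyMeasurable
  simp only [Finset.prod_range]
  refine h.trans ?_
  have hone (i : ℕ) : ∫ x : ℕ → ℝ, arrivalFactor u t (x i) ∂Measure.infinitePi (fun _ : ℕ => Q) =
      Q.real (Set.Icc 0 t) * u + (1 - Q.real (Set.Icc 0 t)) := by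
    have h1 := integral_arrivalFactor_pow Q u t 1
    simp only [pow_one] at h1
    have hm := integral_map (μ := Measure.infinitePi fun _ : ℕ => Q)
      (measurable_pi_apply i).aemeasurable hφ.aestronglyMeasurable
    rw [Measure.infinitePi_map_eval] at hm
    rw [← h1, hm]
  simp [hone]

/-- Independence gives the m-th power of a mean; on the diagonal the product is an m-th power, and
its mean appears. -/
theorem integral_prod_arrivalFactor_equicorrelatedLaw (Q : Measure ℝ) [IsProbabilityMeasure Q]
    {ρ : ℝ} (hρ : ρ ∈ Set.Icc (0 : ℝ) 1) (hu : u ∈ Set.Icc (0 : ℝ) 1) (t : ℝ) (m : ℕ) :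
    ∫ x, ∏ n ∈ Finset.range m, arrivalFactor u t (x n) ∂equicorrelatedLaw Q ρ =
      (1 - ρ) * (Q.real (Set.Icc 0 t) * u + (1 - Q.real (Set.Icc 0 t))) ^ m +
      ρ * (Q.real (Set.Icc 0 t) * u ^ m + (1 - Q.real (Set.Icc 0 t))) := by
  have hdiag : Measurable fun (x : ℝ) (_ : ℕ) => x := measurable_pi_lambda _ fun _ => measurable_id
  have : IsProbabilityMeasure (Q.map fun (x : ℝ) (_ : ℕ) => x) :=
    Measure.isProbabilityMeasure_map hdiag.aemeasurable
  have hint (μ : Measure (ℕ → ℝ)) [IsFiniteMeasure μ] :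
      Integrable (fun x => ∏ n ∈ Finset.range m, arrivalFactor u t (x n)) μ :=
    .of_bound (measurable_prod_arrivalFactor u t m).aestronglyMeasurable 1
      (.of_forall fun x => norm_prod_arrivalFactor_le hu t m x)
  rw [equicorrelatedLaw, integral_add_measure ((hint _).smul_measure ENNReal.ofReal_ne_top)
    ((hint _).smul_measure ENNReal.ofReal_ne_top), integral_smul_measure, integral_smul_measure,
    integral_prod_arrivalFactor_infinitePi,
    integral_map hdiag.aemeasurable (measurable_prod_arrivalFactor u t m).aestronglyMeasurable]
  simp only [Finset.prod_const, Finset.card_range, integral_arrivalFactor_pow, smul_eq_mul]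
  rw [ENNReal.toReal_ofReal hρ.1, ENNReal.toReal_ofReal (sub_nonneg.2 hρ.2)]

theorem integral_pow_countingProcess {Ω : Type*} [MeasurableSpace Ω] {P : Measure Ω}
    [IsProbabilityMeasure P] {M : Ω → ℕ} (hM : Measurable M) {Q : Measure ℝ}
    [IsProbabilityMeasure Q] {X : ℕ → Ω → ℝ} (hX : ∀ n, Measurable (X n)) {ρ : ℝ}
    (hρ : ρ ∈ Set.Icc (0 : ℝ) 1) (hXlaw : P.map (fun ω n => X n ω) = equicorrelatedLaw Q ρ)
    (hindep : IndepFun M (fun ω n => X n ω) P) (hu : u ∈ Set.Icc (0 : ℝ) 1) (t : ℝ) :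
    ∫ ω, u ^ countingProcess M X t ω ∂P =
      (1 - ρ) * ∫ ω, (Q.real (Set.Icc 0 t) * u + (1 - Q.real (Set.Icc 0 t))) ^ M ω ∂P +
      ρ * (Q.real (Set.Icc 0 t) * ∫ ω, u ^ M ω ∂P + (1 - Q.real (Set.Icc 0 t))) := by
  have hX' : Measurable fun ω n => X n ω := measurable_pi_lambda _ hX
  have := Measure.isProbabilityMeasure_map (μ := P) hX'.aemeasurable
  have := Measure.isProbabilityMeasure_map (μ := P) hM.aemeasurable
  set g : ℕ × (ℕ → ℝ) → ℝ := fun p => ∏ n ∈ Finset.range p.1, arrivalFactor u t (p.2 n) with hg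
  have hgm : Measurable g :=
    measurable_from_prod_countable_right fun m => measurable_prod_arrivalFactor u t m
  set F := Q.real (Set.Icc 0 t)
  have hF0 : 0 ≤ F := measureReal_nonneg
  have hF1 : F ≤ 1 := measureReal_le_one
  have hpow {v : ℝ} (hv : v ∈ Set.Icc (0 : ℝ) 1) : Integrable (fun ω => v ^ M ω) P :=
    .of_bound ((measurable_from_nat (f := fun m => v ^ m)).comp hM).aestronglyMeasurable 1
      (.of_forall fun ω => by
        rw [Real.norm_eq_abs, abs_of_nonneg (pow_nonneg hv.1 _)]
        exact pow_le_one₀ hv.1 hv.2)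
  have hv : F * u + (1 - F) ∈ Set.Icc (0 : ℝ) 1 :=
    ⟨by have := mul_nonneg hF0 hu.1; linarith, by have := mul_le_of_le_one_right hF0 hu.2; linarith⟩
  calc ∫ ω, u ^ countingProcess M X t ω ∂P = ∫ ω, g (M ω, fun n => X n ω) ∂P := by
        simp only [pow_countingProcess, hg]
    _ = ∫ p, g p ∂(P.map M).prod (P.map fun ω n => X n ω) := by
        rw [← (indepFun_iff_map_prod_eq_prod_map_map hM.aemeasurable hX'.aemeasurable).1 hindep,
          integral_map (hM.prodMk hX').aemeasurable hgm.aestronglyMeasurable]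
    _ = ∫ m, (1 - ρ) * (F * u + (1 - F)) ^ m + ρ * (F * u ^ m + (1 - F)) ∂P.map M := by
        rw [integral_prod _ (.of_bound hgm.aestronglyMeasurable 1
          (.of_forall fun p => norm_prod_arrivalFactor_le hu t p.1 p.2)), hXlaw]
        simp only [hg, integral_prod_arrivalFactor_equicorrelatedLaw Q hρ hu t, F]
    _ = ∫ ω, ((1 - ρ) * (F * u + (1 - F)) ^ M ω + ρ * (F * u ^ M ω + (1 - F))) ∂P :=
        integral_map hM.aemeasurable measurable_from_nat.aestronglyMeasurable
    _ = _ := by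
        have hFu : Integrable (fun ω => F * u ^ M ω + (1 - F)) P :=
          ((hpow hu).const_mul F).add (integrable_const _)
        rw [integral_add ((hpow hv).const_mul _) (hFu.const_mul ρ), integral_const_mul,
          integral_const_mul, integral_add ((hpow hu).const_mul F) (integrable_const _),
          integral_const_mul]
        simp

theorem hasSum_measureReal_mul_pow {Ω : Type*} [MeasurableSpace Ω] {P : Measure Ω}
    [IsProbabilityMeasure P] {N : Ω → ℕ} (hN : Measurable N) (hu : u ∈ Set.Icc (0 : ℝ) 1) :
    HasSum (fun k => P.real {ω | N ω = k} * u ^ k) (∫ ω, u ^ N ω ∂P) := by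
  have := Measure.isProbabilityMeasure_map (μ := P) hN.aemeasurable
  have hreal (k : ℕ) : (P.map N).real {k} = P.real {ω | N ω = k} :=
    map_measureReal_apply hN (measurableSet_singleton k)
  have hle (k : ℕ) : ‖u ^ k‖ ≤ 1 := by
    rw [Real.norm_eq_abs, abs_of_nonneg (pow_nonneg hu.1 _)]
    exact pow_le_one₀ hu.1 hu.2
  have hint : Integrable (fun k => u ^ k) (P.map N) :=
    .of_bound measurable_from_nat.aestronglyMeasurable 1 (.of_forall hle)
  have hsum : Summable fun k => (P.map N).real {k} := by
    refine ENNReal.summable_toReal ?_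
    rw [← measure_iUnion (fun i j hij => by simpa using hij) measurableSet_singleton]
    exact measure_ne_top _ _
  rw [← integral_map (f := fun k => u ^ k) hN.aemeasurable
    measurable_from_nat.aestronglyMeasurable, integral_countable hint]
  simp only [← hreal, smul_eq_mul]
  refine (hsum.of_norm_bounded fun k => ?_).hasSum
  rw [norm_mul, Real.norm_of_nonneg measureReal_nonneg]
  exact mul_le_of_le_one_right measureReal_nonneg (hle k)

theorem measurable_countingProcess {Ω : Type*} [MeasurableSpace Ω] {M : Ω → ℕ} (hM : Measurable M)
    {X : ℕ → Ω → ℝ} (hX : ∀ n, Measurable (X n)) (t : ℝ) :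
    Measurable (countingProcess M X t) := by
  have h : Measurable fun p : ℕ × (ℕ → ℝ) =>
      ∑ n ∈ Finset.range p.1, (Set.Icc (0 : ℝ) t).indicator (fun _ => 1) (p.2 n) :=
    measurable_from_prod_countable_right fun m =>
      Finset.measurable_fun_sum (Finset.range m) fun n _ =>
        Measurable.comp (g := (Set.Icc (0 : ℝ) t).indicator fun _ => 1)
          (measurable_const.indicator measurableSet_Icc) (measurable_pi_apply n)
  exact h.comp (hM.prodMk (measurable_pi_lambda _ hX))

end

theorem countingPmf_natCast {Ω : Type*} [MeasurableSpace Ω] (P : Measure Ω) (M : Ω → ℕ)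
    (X : ℕ → Ω → ℝ) (t : ℝ) (k : ℕ) :
    countingPmf P M X t k = P.real {ω | countingProcess M X t ω = k} := by
  simp [countingPmf]

theorem countingPmf_of_neg {Ω : Type*} [MeasurableSpace Ω] (P : Measure Ω) (M : Ω → ℕ)
    (X : ℕ → Ω → ℝ) (t : ℝ) {k : ℤ} (hk : k < 0) : countingPmf P M X t k = 0 := by
  have : {ω | (countingProcess M X t ω : ℤ) = k} = ∅ := by
    ext ω
    simp only [Set.mem_ofPred_eq, Set.mem_empty_iff_false, iff_false]
    omega
  rw [countingPmf, this, measureReal_empty]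

/-- No mass lies in (-∞, 0], so the window [0, t] captures all of (-∞, t]. -/
theorem measureReal_Icc_of_cdf_zero {Q : Measure ℝ} [IsProbabilityMeasure Q] (h0 : cdf Q 0 = 0)
    (t : ℝ) : Q.real (Set.Icc 0 t) = cdf Q t := by
  rw [cdf_eq_real] at h0 ⊢
  refine le_antisymm (measureReal_mono Set.Icc_subset_Iic_self) ?_
  calc Q.real (Set.Iic t) ≤ Q.real (Set.Iic 0 ∪ Set.Icc 0 t) :=
        measureReal_mono fun x hx => (le_total x 0).imp id fun h => ⟨h, hx⟩
    _ ≤ Q.real (Set.Iic 0) + Q.real (Set.Icc 0 t) := measureReal_union_le _ _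
    _ = _ := by rw [h0, zero_add]

theorem countingPmf_eq {α ν lam T ρ : ℝ} (hα : α ∈ Set.Ioc (0 : ℝ) 1) (hν : 0 < ν)
    (hlam : 0 < lam) (hT : 0 < T) (hρ : ρ ∈ Set.Icc (0 : ℝ) 1)
    {Ω : Type*} [MeasurableSpace Ω] {P : Measure Ω} [IsProbabilityMeasure P]
    {M : Ω → ℕ} (hM : Measurable M)
    (hpgf : ∀ u ∈ Set.Icc (0 : ℝ) 1,
      ∫ ω, u ^ M ω ∂P = mittagLeffler ν 1 (-(lam ^ α * T ^ ν * (1 - u) ^ α)))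
    {Q : Measure ℝ} [IsProbabilityMeasure Q]
    (hQ : ∀ t ∈ Set.Icc (0 : ℝ) T, cdf Q t = (t / T) ^ (ν / α))
    {X : ℕ → Ω → ℝ} (hX : ∀ n, Measurable (X n))
    (hXlaw : P.map (fun ω n => X n ω) = equicorrelatedLaw Q ρ)
    (hindep : IndepFun M (fun ω n => X n ω) P) {t : ℝ} (ht : t ∈ Set.Icc 0 T) (k : ℕ) :
    countingPmf P M X t k = (1 - ρ) * spaceTimePoissonPmf α ν lam t k +
      ρ * ((t / T) ^ (ν / α) * spaceTimePoissonPmf α ν lam T k +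
        (1 - (t / T) ^ (ν / α)) * if k = 0 then 1 else 0) := by
  have hν' : 0 < ν / α := div_pos hν hα.1
  have hQ0 : cdf Q 0 = 0 := by
    rw [hQ 0 ⟨le_rfl, hT.le⟩, zero_div, Real.zero_rpow hν'.ne']
  have hF : Q.real (Set.Icc 0 t) = (t / T) ^ (ν / α) := by
    rw [measureReal_Icc_of_cdf_zero hQ0, hQ t ht]
  have hF0 : 0 ≤ (t / T) ^ (ν / α) := hF ▸ measureReal_nonneg
  have hF1 : (t / T) ^ (ν / α) ≤ 1 := hF ▸ measureReal_le_one
  -- This is what the exponent ν/α is for: thinning with probability F replaces the horizon T by t.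
  have hFα : T ^ ν * ((t / T) ^ (ν / α)) ^ α = t ^ ν := by
    rw [← Real.rpow_mul (div_nonneg ht.1 hT.le), div_mul_cancel₀ _ hα.1.ne',
      ← Real.mul_rpow hT.le (div_nonneg ht.1 hT.le), mul_div_cancel₀ _ hT.ne']
  set F := (t / T) ^ (ν / α)
  have hδ (u : ℝ) : HasSum (fun k : ℕ => (if k = 0 then 1 else 0) * u ^ k) 1 := by
    convert! hasSum_single (f := fun k : ℕ => (if k = 0 then (1 : ℝ) else 0) * u ^ k) 0
      (fun k hk => by simp [hk]) using 1
    simp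
  refine congrFun (eq_of_hasSum_mul_pow_eq
    (a := fun k : ℕ => countingPmf P M X t k)
    (b := fun k => (1 - ρ) * spaceTimePoissonPmf α ν lam t k +
      ρ * (F * spaceTimePoissonPmf α ν lam T k + (1 - F) * if k = 0 then 1 else 0))
    (f := fun u => ∫ ω, u ^ countingProcess M X t ω ∂P) (fun u hu => ?_) (fun u hu => ?_)) k
  · simp only [countingPmf_natCast]
    exact hasSum_measureReal_mul_pow (measurable_countingProcess hM hX t) ⟨hu.1, hu.2.le⟩
  · have hu' : u ∈ Set.Icc (0 : ℝ) 1 := ⟨hu.1, hu.2.le⟩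
    have hv : F * u + (1 - F) ∈ Set.Icc (0 : ℝ) 1 :=
      ⟨by have := mul_nonneg hF0 hu.1; linarith,
        by have := mul_le_of_le_one_right hF0 hu.2.le; linarith⟩
    simp only [integral_pow_countingProcess hM hX hρ hXlaw hindep hu', hF]
    rw [hpgf u hu', hpgf _ hv, show 1 - (F * u + (1 - F)) = F * (1 - u) by ring,
      Real.mul_rpow hF0 (sub_nonneg.2 hu.2.le), ← mul_assoc, mul_assoc (lam ^ α), hFα]
    have h1 := hasSum_spaceTimePoissonPmf_mul_pow hα hν hlam ht.1 hu
    have h2 := hasSum_spaceTimePoissonPmf_mul_pow hα hν hlam hT.le hu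
    have h := (h1.mul_left (1 - ρ)).add (((h2.mul_left F).add ((hδ u).mul_left (1 - F))).mul_left ρ)
    rw [mul_one] at h
    exact h.congr_fun fun k => by ring

theorem spaceTimePoissonPmf_zero {α ν : ℝ} (hν : 0 < ν) (lam : ℝ) (k : ℕ) :
    spaceTimePoissonPmf α ν lam 0 k = if k = 0 then 1 else 0 := by
  rw [spaceTimePoissonPmf, tsum_eq_single 0]
  · cases k <;> simp [Ring.choose_zero_succ]
  · intro r hr
    rw [Real.zero_rpow hν.ne', zero_pow hr, mul_zero]

/-! ### The Caputo equations -/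

/-- Both equations in one: the indicator of k = 0 vanishes for k ≥ 1, and for k = 0 it supplies the
1 in 1 - p_0(T). -/
theorem hasCaputoDerivAt_countingPmf {α ν lam T ρ : ℝ} (hα : α ∈ Set.Ioc (0 : ℝ) 1)
    (hν : ν ∈ Set.Ioc (0 : ℝ) 1) (hlam : 0 < lam) (hT : 0 < T) (hρ : ρ ∈ Set.Icc (0 : ℝ) 1)
    {Ω : Type*} [MeasurableSpace Ω] {P : Measure Ω} [IsProbabilityMeasure P]
    {M : Ω → ℕ} (hM : Measurable M)
    (hpgf : ∀ u ∈ Set.Icc (0 : ℝ) 1,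
      ∫ ω, u ^ M ω ∂P = mittagLeffler ν 1 (-(lam ^ α * T ^ ν * (1 - u) ^ α)))
    {Q : Measure ℝ} [IsProbabilityMeasure Q]
    (hQ : ∀ t ∈ Set.Icc (0 : ℝ) T, cdf Q t = (t / T) ^ (ν / α))
    {X : ℕ → Ω → ℝ} (hX : ∀ n, Measurable (X n))
    (hXlaw : P.map (fun ω n => X n ω) = equicorrelatedLaw Q ρ)
    (hindep : IndepFun M (fun ω n => X n ω) P) {t : ℝ} (ht : t ∈ Set.Ioc 0 T) (k : ℕ) :
    HasCaputoDerivAt ν T (fun s => countingPmf P M X s k)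
      (-lam ^ α * fracDiff α (countingPmf P M X t) k
        + lam ^ α * ρ * (1 - (t / T) ^ (ν / α)) * ((-1) ^ k * Ring.choose α k)
        + ρ * (t / T) ^ (ν / α)
          * (lam ^ α * fracDiff α (countingPmf P M X T) k
            + t ^ (-ν) * (Real.Gamma (ν / α + 1) / Real.Gamma (ν / α - ν + 1))
              * (countingPmf P M X T k - if k = 0 then 1 else 0))) t := by
  have hp {s : ℝ} (hs : s ∈ Set.Icc 0 T) (j : ℕ) :=
    countingPmf_eq hα hν.1 hlam hT hρ hM hpgf hQ hX hXlaw hindep hs j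
  have hβ : 0 < ν / α := div_pos hν.1 hα.1
  set S : ℝ → ℝ := fun s => ∑ ij ∈ Finset.HasAntidiagonal.antidiagonal k,
    (-1) ^ ij.1 * Ring.choose α ij.1 * spaceTimePoissonPmf α ν lam s ij.2 with hS
  have hdelta : ∑ ij ∈ Finset.HasAntidiagonal.antidiagonal k,
      (-1) ^ ij.1 * Ring.choose α ij.1 * (if ij.2 = 0 then 1 else 0) =
      (-1) ^ k * Ring.choose α k := by
    rw [Finset.sum_eq_single (k, 0)]
    · simp
    · rintro ⟨i, j⟩ hij hne
      have hj : j ≠ 0 := by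
        rintro rfl
        simp_all
      simp [hj]
    · simp
  have hfrac {s : ℝ} (hs : s ∈ Set.Icc 0 T) : fracDiff α (countingPmf P M X s) k =
      (1 - ρ) * S s + ρ * ((s / T) ^ (ν / α) * S T +
        (1 - (s / T) ^ (ν / α)) * ((-1) ^ k * Ring.choose α k)) := by
    rw [fracDiff_eq_sum (fun j hj => countingPmf_of_neg P M X s hj), ← hdelta, hS]
    simp only [hp hs, Finset.mul_sum, ← Finset.sum_add_distrib]
    exact Finset.sum_congr rfl fun ij _ => by ring
  have hTT : T ∈ Set.Icc 0 T := ⟨hT.le, le_rfl⟩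
  have htT : t ∈ Set.Icc 0 T := ⟨ht.1.le, ht.2⟩
  have hpT : countingPmf P M X T k = spaceTimePoissonPmf α ν lam T k := by
    rw [hp hTT, div_self hT.ne', Real.one_rpow]
    ring
  have hfT : fracDiff α (countingPmf P M X T) k = S T := by
    rw [hfrac hTT, div_self hT.ne', Real.one_rpow]
    ring
  set δ : ℝ := if k = 0 then 1 else 0
  -- Decomposition of p_k(s) into (1-ρ) q_k(s), a multiple of s^{ν/α}, and the constant ρδ.
  have h := (((hasCaputoDerivAt_spaceTimePoissonPmf (lam := lam) (T := T) hα hν.1 hν.2 ht.1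
    k).const_mul (1 - ρ)).add ht.1 ((hasCaputoDerivAt_rpow (T := T) hν.1 hν.2 ht.1 hβ).const_mul
    (ρ * (spaceTimePoissonPmf α ν lam T k - δ) / T ^ (ν / α)))).add ht.1
    (hasCaputoDerivAt_const (T := T) hν.1 hν.2 ht.1 (ρ * δ))
  have hval := h.congr (g := fun s => countingPmf P M X s k) ht fun s hs => by
    rw [hp hs, Real.div_rpow hs.1 hT.le]
    ring
  convert! hval using 1
  rw [hfrac htT, hfT, hpT, sub_eq_add_neg (ν / α) ν, Real.rpow_add ht.1,
    Real.div_rpow ht.1.le hT.le]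
  ring

theorem proposition3
    (α ν lam T ρ : ℝ) (hα : α ∈ Set.Ioc (0 : ℝ) 1) (hν : ν ∈ Set.Ioc (0 : ℝ) 1)
    (hlam : 0 < lam) (hT : 0 < T) (hρ : ρ ∈ Set.Icc (0 : ℝ) 1)
    {Ω : Type*} [MeasurableSpace Ω] (P : Measure Ω) [IsProbabilityMeasure P]
    (M : Ω → ℕ) (hM : Measurable M)
    (hpgf : ∀ u ∈ Set.Icc (0 : ℝ) 1,
      ∫ ω, u ^ M ω ∂P = mittagLeffler ν 1 (-(lam ^ α * T ^ ν * (1 - u) ^ α)))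
    (Q : Measure ℝ) [IsProbabilityMeasure Q]
    (hQ : ∀ t ∈ Set.Icc (0 : ℝ) T, cdf Q t = (t / T) ^ (ν / α))
    (X : ℕ → Ω → ℝ) (hX : ∀ n, Measurable (X n))
    (hXlaw : P.map (fun ω n => X n ω) = equicorrelatedLaw Q ρ)
    (hindep : IndepFun M (fun ω n => X n ω) P) :
    (∀ t ∈ Set.Ioc (0 : ℝ) T,
      HasCaputoDerivAt ν T (fun s => countingPmf P M X s 0)
        (-lam ^ α * countingPmf P M X t 0 + lam ^ α * ρ
          - ρ * (t / T) ^ (ν / α)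
            * (lam ^ α
              + t ^ (-ν) * (Real.Gamma (ν / α + 1) / Real.Gamma (ν / α - ν + 1)))
            * (1 - countingPmf P M X T 0)) t) ∧
    (∀ k : ℕ, 1 ≤ k → ∀ t ∈ Set.Ioc (0 : ℝ) T,
      HasCaputoDerivAt ν T (fun s => countingPmf P M X s k)
        (-lam ^ α * fracDiff α (countingPmf P M X t) k
          + lam ^ α * ρ * (1 - (t / T) ^ (ν / α)) * ((-1) ^ k * Ring.choose α k)
          + ρ * (t / T) ^ (ν / α)
            * (lam ^ α * fracDiff α (countingPmf P M X T) k
              + t ^ (-ν) * (Real.Gamma (ν / α + 1) / Real.Gamma (ν / α - ν + 1))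
                * countingPmf P M X T k)) t) ∧
    countingPmf P M X 0 0 = 1 ∧
    (∀ k : ℕ, 1 ≤ k → countingPmf P M X 0 k = 0) := by
  have key {t : ℝ} (ht : t ∈ Set.Ioc 0 T) (k : ℕ) :=
    hasCaputoDerivAt_countingPmf hα hν hlam hT hρ hM hpgf hQ hX hXlaw hindep ht k
  have hzero (k : ℕ) : countingPmf P M X 0 k = if k = 0 then 1 else 0 := by
    rw [countingPmf_eq hα hν.1 hlam hT hρ hM hpgf hQ hX hXlaw hindep ⟨le_rfl, hT.le⟩, zero_div,
      Real.zero_rpow (div_pos hν.1 hα.1).ne', spaceTimePoissonPmf_zero hν.1]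
    ring
  refine ⟨fun t ht => ?_, fun k hk t ht => ?_, by simpa using hzero 0, fun k hk => ?_⟩
  · have h := key ht 0
    -- At k = 0 only the term j = 0 survives, so (I-B)^α p_0 = p_0.
    rw [fracDiff_eq_sum (fun j hj => countingPmf_of_neg P M X t hj),
      fracDiff_eq_sum (fun j hj => countingPmf_of_neg P M X T hj)] at h
    simp only [Finset.HasAntidiagonal.antidiagonal_zero, Finset.sum_singleton, pow_zero, Ring.choose_zero_right,
      one_mul, mul_one, if_true, Nat.cast_zero] at h
    convert! h using 1
    ring
  · have h := key ht k
    rwa [if_neg (by omega), sub_zero] at h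
  · rw [hzero, if_neg (by omega)]
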